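/- Let $N\cong\mathbb Z^3$ be a lattice, $N_{\mathbb R}=N\otimes\mathbb R$, and let $\sigma\subseteq N_{\mathbb R}$ be a strongly convex rational polyhedral cone that is nondegenerate (three-dimensional), with affine toric variety $X_\sigma$. For a cone $\tau$ let $\mathrm{Gen}(\tau)\subseteq N$ be the set of primitive lattice generators of its one-dimensional faces, and for a fan $\Sigma$ put $\mathrm{Gen}(\Sigma)=\bigcup_{\tau\in\Sigma}\mathrm{Gen}(\tau)$. A cone is smooth if its minimal generators are part of a $\mathbb Z$-basis of $N$. A subdivision of $\sigma$ is a (finite) fan $\Sigma$ of strongly convex rational polyhedral cones with support $\sigma$; it is a toric resolution if all its cones are smooth. A subdivision $\Sigma$ of $\sigma$ is a moderate toric resolution if every nondegenerate cone $\tau\in\Sigma$ is smooth and the affine hyperplane spanned by $\mathrm{Gen}(\tau)$ meets every one-dimensional face of $\sigma$. The canonical divisor of a toric variety is $K=-\sum_u D_u$, the sum running over the torus invariant prime divisors $D_u$, indexed by the primitive ray generators $u$ of its fan. $X_\sigma$ is canonical if $K_{X_\sigma}$ is $\mathbb Q$-Cartier and, for every subdivision $\Sigma'$ of $\sigma$ with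 induced morphism $\varphi\colon X_{\Sigma'}\to X_\sigma$, all coefficients of $K_{X_{\Sigma'}}-\varphi^*K_{X_\sigma}$ are nonnegative. A toric resolution $\varphi\colon X_\Sigma\to X_\sigma$ is crepant if $K_{X_\sigma}$ is $\mathbb Q$-Cartier and $K_{X_\Sigma}=\varphi^*K_{X_\sigma}$. Suppose that $X_\sigma$ is canonical and that $\Sigma$ is a moderate toric resolution of $\sigma$. Then $\Sigma$ is a crepant toric resolution of $\sigma$. Moreover, the affine span of $\mathrm{Gen}(\sigma)$ is an affine hyperplane of $N_{\mathbb R}$, and it contains $\mathrm{Gen}(\Sigma)$. -/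

import Mathlib

open scoped TensorProduct

namespace Toric

section

variable (N : Type*) [AddCommGroup N]

/-- The real vector space `N_ℝ = ℝ ⊗ N` of a lattice `N`. -/
abbrev RealSpace : Type _ := ℝ ⊗[ℤ] N

variable {N}

/-- The canonical map `N → N_ℝ`, `n ↦ 1 ⊗ n`. -/
def toReal (n : N) : RealSpace N := (1 : ℝ) ⊗ₜ[ℤ] n

/-- A cone in the sense of toric geometry: a strongly convex rational polyhedral cone
`Cone(u₁, …, uₛ) ⊆ N_ℝ` with `u₁, …, uₛ ∈ N`. -/
structure IsToricCone (σ : PointedCone ℝ (RealSpace N)) : Prop where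
  rational_polyhedral : ∃ s : Finset N, σ = PointedCone.hull ℝ (toReal '' (s : Set N))
  strongly_convex : ∀ x ∈ σ, -x ∈ σ → x = 0

/-- A cone is nondegenerate if it is full-dimensional, i.e. it spans `N_ℝ`. -/
def IsNondegenerate (σ : PointedCone ℝ (RealSpace N)) : Prop :=
  Submodule.span ℝ (σ : Set (RealSpace N)) = ⊤

/-- One-dimensional faces of a cone. -/
def IsRayOf (ρ σ : PointedCone ℝ (RealSpace N)) : Prop :=
  ρ.IsFaceOf σ ∧ Module.finrank ℝ (Submodule.span ℝ (ρ : Set (RealSpace N))) = 1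

/-- `n ∈ N` is primitive if `ε n ∉ N` for all real `0 < ε < 1` (in particular `n ≠ 0`). -/
def IsPrimitive (n : N) : Prop :=
  ∀ ε : ℝ, 0 < ε → ε < 1 → ε • toReal n ∉ Set.range (toReal : N → RealSpace N)

/-- The minimal generators `Gen(σ)` of a cone: the primitive lattice vectors `P(ρ)` spanning
the one-dimensional faces `ρ` of `σ`. -/
def gen (σ : PointedCone ℝ (RealSpace N)) : Set N :=
  {n | IsPrimitive n ∧ IsRayOf (PointedCone.hull ℝ {toReal n}) σ}

/-- A cone is smooth if its minimal generators are part of a `ℤ`-basis of `N`. -/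
def IsSmooth (σ : PointedCone ℝ (RealSpace N)) : Prop :=
  ∃ b : Module.Basis (Fin (Module.finrank ℤ N)) ℤ N, gen σ ⊆ Set.range b

variable (N) in
/-- A fan in `N_ℝ`: a finite collection of strongly convex rational polyhedral cones, closed under
taking faces, any two of which meet in a common face. -/
structure Fan where
  cones : Set (PointedCone ℝ (RealSpace N))
  finite : cones.Finite
  isToricCone : ∀ τ ∈ cones, IsToricCone τ
  face_mem : ∀ τ ∈ cones, ∀ F : PointedCone ℝ (RealSpace N), F.IsFaceOf τ → F ∈ cones
  inf_isFaceOf : ∀ τ ∈ cones, ∀ τ' ∈ cones, (τ ⊓ τ').IsFaceOf τ ∧ (τ ⊓ τ').IsFaceOf τ'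

/-- `Gen(Σ)`, the union of the sets `Gen(τ)` over the cones `τ` of the fan `Σ`. Its elements are
the primitive generators of the rays of `Σ`, hence they index the torus invariant prime divisors
on the toric variety `X_Σ`. -/
def Fan.gen (S : Fan N) : Set N := ⋃ τ ∈ S.cones, Toric.gen τ

/-- The fan `Σ` is a subdivision of the cone `σ`: its support `⋃_{τ ∈ Σ} τ` is `σ`. These are the
fans whose toric varieties have a toric proper birational morphism `X_Σ → X_σ`. -/
def Fan.IsSubdivision (S : Fan N) (σ : PointedCone ℝ (RealSpace N)) : Prop :=
  (⋃ τ ∈ S.cones, (τ : Set (RealSpace N))) = σ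

/-- `Σ` is a toric resolution of `σ`: a subdivision all of whose cones are smooth. -/
def Fan.IsResolution (S : Fan N) (σ : PointedCone ℝ (RealSpace N)) : Prop :=
  S.IsSubdivision σ ∧ ∀ τ ∈ S.cones, IsSmooth τ

/-- The affine span of `Gen(σ)` in `N_ℝ`. If `σ` is nondegenerate and simplicial, it is the affine
hyperplane `{l_σ = 1}`. -/
noncomputable def genSpan (σ : PointedCone ℝ (RealSpace N)) : AffineSubspace ℝ (RealSpace N) :=
  affineSpan ℝ (toReal '' gen σ)

/-- `Σ` is a moderate toric resolution of `σ`: a subdivision such that every nondegenerate cone `τ`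
of `Σ` is smooth and the affine hyperplane spanned by `Gen(τ)` meets every one-dimensional face
of `σ`. -/
structure Fan.IsModerateResolution (S : Fan N) (σ : PointedCone ℝ (RealSpace N)) : Prop where
  isSubdivision : S.IsSubdivision σ
  isSmooth : ∀ τ ∈ S.cones, IsNondegenerate τ → IsSmooth τ
  meets : ∀ τ ∈ S.cones, IsNondegenerate τ → ∀ ρ : PointedCone ℝ (RealSpace N), IsRayOf ρ σ →
    ((genSpan τ : Set (RealSpace N)) ∩ (ρ : Set (RealSpace N))).Nonempty

/-- Torus invariant `ℚ`-divisors on a toric variety whose fan has the set `G` of primitive ray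
generators: `D = ∑_{u ∈ G} D(u) D_u`, where `D_u` is the torus invariant prime divisor of `u`. -/
abbrev InvDivisor (G : Set N) : Type _ := G → ℚ

/-- The principal divisor `div(χ^m) = ∑_u ⟨m, u⟩ D_u` of the character `χ^m`, for
`m ∈ M = Hom(N, ℤ)`. -/
def divChar (G : Set N) (m : N →ₗ[ℤ] ℤ) : InvDivisor G := fun u => (m (u : N) : ℚ)

/-- The torus invariant canonical divisor `K = - ∑_u D_u` of a toric variety. -/
def canonicalDivisor (G : Set N) : InvDivisor G := fun _ => -1

/-- A torus invariant `ℚ`-divisor `D` on the affine toric variety `X_σ` is `ℚ`-Cartier if `r D` is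
Cartier for some integer `r > 0`; on an affine toric variety the torus invariant Cartier divisors
are the divisors of characters, so this says `r D = div(χ^m)` for some `m ∈ M`. -/
def IsQCartier (σ : PointedCone ℝ (RealSpace N)) (D : InvDivisor (gen σ)) : Prop :=
  ∃ r : ℕ, 0 < r ∧ ∃ m : N →ₗ[ℤ] ℤ, r • D = divChar (gen σ) m

/-- `D'` is the pullback to `X_Σ` of the `ℚ`-Cartier divisor `D` on `X_σ`, along the toric
morphism `X_Σ → X_σ` of a subdivision `Σ` of `σ`: if `r D = div(χ^m)` on `X_σ`, then
`r D' = div(χ^m)` on `X_Σ`. -/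
def IsPullback (σ : PointedCone ℝ (RealSpace N)) (S : Fan N)
    (D : InvDivisor (gen σ)) (D' : InvDivisor S.gen) : Prop :=
  ∃ r : ℕ, 0 < r ∧ ∃ m : N →ₗ[ℤ] ℤ,
    r • D = divChar (gen σ) m ∧ r • D' = divChar S.gen m

/-- `X_σ` is `ℚ`-Gorenstein: its canonical divisor is `ℚ`-Cartier. -/
def IsQGorenstein (σ : PointedCone ℝ (RealSpace N)) : Prop :=
  IsQCartier σ (canonicalDivisor (gen σ))

/-- `X_σ` has canonical singularities: it is `ℚ`-Gorenstein and, for every toric proper birational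
morphism `φ : X_Σ → X_σ`, all coefficients of the discrepancy divisor `K_{X_Σ} - φ^* K_{X_σ}`
are nonnegative. -/
def IsCanonical (σ : PointedCone ℝ (RealSpace N)) : Prop :=
  IsQGorenstein σ ∧
    ∀ S : Fan N, S.IsSubdivision σ → ∀ P : InvDivisor S.gen,
      IsPullback σ S (canonicalDivisor (gen σ)) P →
        ∀ u : S.gen, 0 ≤ (canonicalDivisor S.gen - P) u

/-- `Σ` is a crepant resolution of `σ`: it is a toric resolution and `K_{X_Σ} = φ^* K_{X_σ}` for
the morphism `φ : X_Σ → X_σ` (in particular `K_{X_σ}` is `ℚ`-Cartier). -/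
def Fan.IsCrepantResolution (S : Fan N) (σ : PointedCone ℝ (RealSpace N)) : Prop :=
  S.IsResolution σ ∧ IsPullback σ S (canonicalDivisor (Toric.gen σ)) (canonicalDivisor S.gen)

end

end Toric

namespace Toric

section

variable {N : Type*} [AddCommGroup N]

/-! Since `K` is `ℚ`-Cartier, some linear `l` equals `1` on `Gen(σ)`, and the discrepancy along
`D_u` is `l u - 1`; canonicity thus gives `l ≥ 1` on `Gen(Σ)`. For the reverse bound, let `f` be the
sum of the coordinates in a lattice basis containing `Gen(τ)`, with `τ` nondegenerate in `Σ`. It is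
integral on `N` and equals `1` on the affine span of `Gen(τ)`. That span meets each ray of `σ`, so
`f > 0` on `Gen(σ)`, hence `f ≥ 1 = l` there by integrality, hence `l ≤ f` on `σ`, and `l ≤ 1` on
`Gen(τ)` (`le_one_of_genSpan_meets`). Every cone of `Σ` is a face of a nondegenerate one
(`exists_isNondegenerate_isFaceOf`), so all cones are smooth and `l = 1` on `Gen(Σ)`, which is
crepancy. As `Gen(σ)` spans `N_ℝ`, its affine span is all of `{l = 1}`. -/

theorem exists_realExtension (m : N →ₗ[ℤ] ℤ) :
    ∃ f : RealSpace N →ₗ[ℝ] ℝ, ∀ n, f (toReal n) = m n :=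
  ⟨(TensorProduct.AlgebraTensorModule.rid ℤ ℝ ℝ).toLinearMap ∘ₗ m.baseChange ℝ, fun n => by
    simp [toReal]⟩

theorem toReal_zero : toReal (0 : N) = 0 := TensorProduct.tmul_zero _ _

theorem mem_hull_singleton {v x : RealSpace N} :
    x ∈ PointedCone.hull ℝ {v} ↔ ∃ c : ℝ, 0 ≤ c ∧ c • v = x := by
  rw [Submodule.mem_span_singleton]
  exact ⟨fun ⟨c, hc⟩ => ⟨c, c.2, hc⟩, fun ⟨c, h0, hc⟩ => ⟨⟨c, h0⟩, hc⟩⟩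

theorem hull_singleton_smul {c : ℝ} (hc : 0 < c) (v : RealSpace N) :
    PointedCone.hull ℝ {c • v} = PointedCone.hull ℝ {v} := by
  ext x
  simp only [mem_hull_singleton]
  constructor
  · rintro ⟨d, hd, rfl⟩
    exact ⟨d * c, by positivity, by rw [mul_smul]⟩
  · rintro ⟨d, hd, rfl⟩
    exact ⟨d / c, by positivity, by rw [smul_smul, div_mul_cancel₀ _ hc.ne']⟩

theorem span_hull (s : Set (RealSpace N)) :
    Submodule.span ℝ (PointedCone.hull ℝ s : Set (RealSpace N)) = Submodule.span ℝ s :=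
  le_antisymm (Submodule.span_le.2 (PointedCone.hull_le_span ℝ s))
    (Submodule.span_mono PointedCone.subset_hull)

theorem le_on_hull {s : Set (RealSpace N)} {f g : RealSpace N →ₗ[ℝ] ℝ}
    (h : ∀ v ∈ s, f v ≤ g v) {x : RealSpace N} (hx : x ∈ PointedCone.hull ℝ s) : f x ≤ g x := by
  induction hx using Submodule.span_induction with
  | mem x hx => exact h x hx
  | zero => simp
  | add x y _ _ hx hy => simpa using add_le_add hx hy
  | smul a x _ hx =>
    change f ((a : ℝ) • x) ≤ g ((a : ℝ) • x)
    rw [map_smul, map_smul]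
    exact mul_le_mul_of_nonneg_left hx a.2

/-! ### Rays and primitive generators of toric cones. -/

/-- A generating set of least cardinality works: a redundant element could be erased. -/
theorem IsToricCone.exists_irredundant {σ : PointedCone ℝ (RealSpace N)} (hσ : IsToricCone σ) :
    ∃ s : Finset N, σ = PointedCone.hull ℝ (toReal '' (s : Set N)) ∧
      ∀ v ∈ s, toReal v ∉ PointedCone.hull ℝ (toReal '' ((s : Set N) \ {v})) := by
  classical
  let P : ℕ → Prop := fun k => ∃ s : Finset N, s.card = k ∧
    σ = PointedCone.hull ℝ (toReal '' (s : Set N))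
  have hP : ∃ k, P k := by
    obtain ⟨s, hs⟩ := hσ.rational_polyhedral
    exact ⟨_, s, rfl, hs⟩
  obtain ⟨s, hcard, hs⟩ := Nat.find_spec hP
  refine ⟨s, hs, fun v hv hmem => ?_⟩
  refine Nat.find_min hP (m := (s.erase v).card) ?_ ⟨s.erase v, rfl, ?_⟩
  · rw [← hcard]; exact Finset.card_erase_lt_of_mem hv
  · rw [hs]
    apply le_antisymm
    · refine Submodule.span_le.2 ?_
      rintro _ ⟨w, hw, rfl⟩
      by_cases h : w = v
      · subst h; simpa using hmem
      · exact PointedCone.subset_hull ⟨w, by simpa [h] using hw, rfl⟩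
    · exact Submodule.span_mono (Set.image_mono (by simp))

/-- In a strongly convex cone, an irredundant generator spans a one-dimensional face. -/
theorem isRayOf_of_irredundant {σ : PointedCone ℝ (RealSpace N)} (hσ : IsToricCone σ)
    {s : Finset N} (hs : σ = PointedCone.hull ℝ (toReal '' (s : Set N))) {v : N} (hv : v ∈ s)
    (hirr : toReal v ∉ PointedCone.hull ℝ (toReal '' ((s : Set N) \ {v}))) :
    IsRayOf (PointedCone.hull ℝ {toReal v}) σ := by
  set R := PointedCone.hull ℝ (toReal '' ((s : Set N) \ {v})) with hR
  have hvσ : toReal v ∈ σ := hs ▸ PointedCone.subset_hull ⟨v, hv, rfl⟩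
  have hRσ : R ≤ σ := hs ▸ Submodule.span_mono (Set.image_mono Set.sdiff_subset)
  have hdec : ∀ x ∈ σ, ∃ a : ℝ, 0 ≤ a ∧ ∃ z ∈ R, x = a • toReal v + z := by
    intro x hx
    have hins : (toReal '' (s : Set N)) = insert (toReal v) (toReal '' ((s : Set N) \ {v})) := by
      rw [← Set.image_insert_eq, Set.insert_sdiff_singleton, Set.insert_eq_of_mem (by simpa)]
    rw [hs, hins] at hx
    obtain ⟨a, z, hz, rfl⟩ := Submodule.mem_span_insert.1 hx
    exact ⟨a, a.2, z, hz, rfl⟩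
  have hsm : ∀ {C : PointedCone ℝ (RealSpace N)} {c : ℝ} {x}, 0 ≤ c → x ∈ C → c • x ∈ C :=
    fun {C c x} hc hx => PointedCone.smul_mem C hc hx
  refine ⟨⟨?_, ?_⟩, ?_⟩
  · exact Submodule.span_le.2 (by simpa using hvσ)
  · intro x y a hx hy ha hxy
    obtain ⟨c, hc, hcv⟩ := mem_hull_singleton.1 hxy
    obtain ⟨p, hp, z, hz, rfl⟩ := hdec x hx
    obtain ⟨q, hq, w, hw, rfl⟩ := hdec y hy
    have key : (c - (a * p + q)) • toReal v = a • z + w := by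
      rw [sub_smul, hcv]; module
    have hzw : a • z + w ∈ R := R.add_mem (hsm ha.le hz) hw
    -- A positive coefficient in `key` would put `v` in `R`, against irredundancy.
    have hle : c - (a * p + q) ≤ 0 := by
      by_contra! h
      refine hirr ?_
      rw [← key] at hzw
      have := hsm (inv_nonneg.2 h.le) hzw
      rwa [smul_smul, inv_mul_cancel₀ h.ne', one_smul] at this
    have haz : a • z = 0 := by
      refine hσ.strongly_convex _ (hRσ (hsm ha.le hz)) ?_
      have : -(a • z) = w + (-(c - (a * p + q))) • toReal v := by
        rw [neg_smul, key]; module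
      rw [this]
      exact σ.add_mem (hRσ hw) (hsm (by linarith) hvσ)
    have hz0 : z = 0 := (smul_eq_zero.1 haz).resolve_left ha.ne'
    exact mem_hull_singleton.2 ⟨p, hp, by simp [hz0]⟩
  · rw [span_hull]
    refine finrank_span_singleton fun h => hirr ?_
    rw [h]; exact R.zero_mem

section Lattice

variable [Module.Free ℤ N]

theorem toReal_injective : Function.Injective (toReal : N → RealSpace N) := by
  intro v w h
  refine (Module.Free.chooseBasis ℤ N).ext_elem fun i => ?_
  obtain ⟨f, hf⟩ := exists_realExtension ((Module.Free.chooseBasis ℤ N).coord i)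
  have := hf v
  rw [h, hf w] at this
  exact_mod_cast this.symm

variable [Module.Finite ℤ N]

/-- Every nonzero lattice vector is a multiple of a primitive one. -/
theorem exists_isPrimitive_smul (v : N) (hv : v ≠ 0) :
    ∃ p : N, IsPrimitive p ∧ ∃ c : ℝ, 0 < c ∧ toReal p = c • toReal v := by
  let b := Module.Free.chooseBasis ℤ N
  -- Descent: if `v` is not primitive, some `w = ε v` with `0 < ε < 1` is a lattice vector, and the
  -- sum of absolute coordinates shrinks by the factor `ε`.
  induction hk : ∑ i, (b.coord i v).natAbs using Nat.strong_induction_on generalizing v with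
  | _ k ih =>
  by_cases hp : IsPrimitive v
  · exact ⟨v, hp, 1, one_pos, by simp⟩
  unfold IsPrimitive at hp
  push Not at hp
  obtain ⟨ε, h0, h1, w, hw⟩ := hp
  have hcoord : ∀ i, ((b.coord i w).natAbs : ℝ) = ε * (b.coord i v).natAbs := fun i => by
    obtain ⟨f, hf⟩ := exists_realExtension (b.coord i)
    have h : ((b.coord i w : ℤ) : ℝ) = ε * (b.coord i v : ℤ) := by
      rw [← hf, ← hf, hw, map_smul, smul_eq_mul]
    rw [Nat.cast_natAbs, Nat.cast_natAbs, Int.cast_abs, Int.cast_abs, h, abs_mul,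
      abs_of_pos h0]
  have hsum : ((∑ i, (b.coord i w).natAbs : ℕ) : ℝ) = ε * (∑ i, (b.coord i v).natAbs : ℕ) := by
    push_cast
    rw [Finset.mul_sum]
    exact Finset.sum_congr rfl fun i _ => hcoord i
  have hpos : 0 < ∑ i, (b.coord i v).natAbs := by
    refine Nat.pos_of_ne_zero fun h => hv (b.ext_elem fun i => ?_)
    have := (Finset.sum_eq_zero_iff.1 h) i (Finset.mem_univ _)
    simpa using this
  have hlt : ∑ i, (b.coord i w).natAbs < k := by
    rw [← hk]
    have : (0 : ℝ) < (∑ i, (b.coord i v).natAbs : ℕ) := by exact_mod_cast hpos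
    have : ((∑ i, (b.coord i w).natAbs : ℕ) : ℝ) < (∑ i, (b.coord i v).natAbs : ℕ) := by
      rw [hsum]; nlinarith
    exact_mod_cast this
  have hw0 : w ≠ 0 := by
    rintro rfl
    rw [toReal_zero, eq_comm, smul_eq_zero] at hw
    exact hw.elim h0.ne' fun h => hv (toReal_injective (h.trans toReal_zero.symm))
  obtain ⟨p, hp, c, hc, hpw⟩ := ih _ hlt w hw0 rfl
  exact ⟨p, hp, c * ε, by positivity, by rw [hpw, hw, smul_smul]⟩

/-- A toric cone is generated by the primitive generators of its rays. -/
theorem IsToricCone.hull_gen {σ : PointedCone ℝ (RealSpace N)} (hσ : IsToricCone σ) :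
    PointedCone.hull ℝ (toReal '' gen σ) = σ := by
  apply le_antisymm
  · refine Submodule.span_le.2 ?_
    rintro _ ⟨u, hu, rfl⟩
    exact hu.2.1.le (PointedCone.subset_hull rfl)
  · obtain ⟨s, hs, hirr⟩ := hσ.exists_irredundant
    conv_lhs => rw [hs]
    refine Submodule.span_le.2 ?_
    rintro _ ⟨v, hv, rfl⟩
    have hray := isRayOf_of_irredundant hσ hs hv (hirr v hv)
    have hv0 : v ≠ 0 := by
      rintro rfl
      refine hirr 0 hv ?_
      rw [toReal_zero]; exact Submodule.zero_mem _
    obtain ⟨p, hp, c, hc, hpv⟩ := exists_isPrimitive_smul v hv0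
    have hhull : PointedCone.hull ℝ {toReal p} = PointedCone.hull ℝ {toReal v} := by
      rw [hpv, hull_singleton_smul hc]
    have hpg : p ∈ gen σ := ⟨hp, hhull ▸ hray⟩
    have : toReal v ∈ PointedCone.hull ℝ {toReal p} := by
      rw [hhull]; exact PointedCone.subset_hull rfl
    exact Submodule.span_mono (Set.singleton_subset_iff.2 (Set.mem_image_of_mem _ hpg)) this

theorem IsToricCone.span_gen {σ : PointedCone ℝ (RealSpace N)} (hσ : IsToricCone σ)
    (hnd : IsNondegenerate σ) : Submodule.span ℝ (toReal '' gen σ) = ⊤ := by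
  rw [← span_hull, hσ.hull_gen, hnd]

end Lattice
end
end Toric

namespace Toric

section

variable {N : Type*} [AddCommGroup N]

/-! ### Nondegenerate cones of a subdivision. -/

/-- Supplies a generic direction for perturbing points of `σ` away from the degenerate cones of a
fan. -/
theorem exists_mem_forall_notMem_submodule {σ : PointedCone ℝ (RealSpace N)}
    (hnd : IsNondegenerate σ) {T : Set (Submodule ℝ (RealSpace N))} (hT : T.Finite)
    (hne : ∀ W ∈ T, W ≠ ⊤) : ∃ y ∈ σ, ∀ W ∈ T, y ∉ W := by
  induction T, hT using Set.Finite.induction_on with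
  | empty => exact ⟨0, σ.zero_mem, by simp⟩
  | @insert W T _ hT ih =>
    obtain ⟨y, hy, hyT⟩ := ih fun V hV => hne V (Set.mem_insert_of_mem _ hV)
    by_cases hyW : y ∈ W
    swap
    · exact ⟨y, hy, by simpa [hyW] using hyT⟩
    obtain ⟨z, hz, hzW⟩ : ∃ z ∈ σ, z ∉ W := by
      by_contra! h
      refine hne W (Set.mem_insert _ _) (top_le_iff.1 ?_)
      rw [← show _ = ⊤ from hnd]
      exact Submodule.span_le.2 h
    -- Two of the points `y + z / (n + 1)` in the same `V` would force `z ∈ V` and then `y ∈ V`, so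
    -- each `V` excludes at most one `n`.
    have hfin : (⋃ V ∈ T, {n : ℕ | y + (1 / (n + 1 : ℝ)) • z ∈ V}).Finite := by
      refine hT.biUnion fun V hV => Set.Subsingleton.finite fun n hn m hm => ?_
      by_contra hnm
      have hd : (1 / (n + 1 : ℝ) - 1 / (m + 1)) ≠ 0 := by
        intro h
        have : (n : ℝ) + 1 = m + 1 := by
          have := sub_eq_zero.1 h
          rwa [one_div, one_div, inv_inj] at this
        exact hnm (by exact_mod_cast add_right_cancel this)
      have hzV : z ∈ V := by
        have : (1 / (n + 1 : ℝ) - 1 / (m + 1)) • z ∈ V := by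
          convert V.sub_mem hn hm using 1
          module
        exact (V.smul_mem_iff hd).1 this
      refine hyT V hV ?_
      have := V.sub_mem hn (V.smul_mem (1 / (n + 1 : ℝ)) hzV)
      simpa using this
    obtain ⟨n, hn⟩ := hfin.exists_notMem
    simp only [Set.mem_iUnion, not_exists] at hn
    have hpos : (0 : ℝ) < 1 / (n + 1) := by positivity
    refine ⟨y + (1 / (n + 1 : ℝ)) • z, σ.add_mem hy (PointedCone.smul_mem σ hpos.le hz), ?_⟩
    intro V hV
    rcases hV with rfl | hV
    · intro h
      exact hzW ((V.smul_mem_iff hpos.ne').1 ((V.add_mem_iff_right hyW).1 h))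
    · exact hn V hV

theorem gen_subset_of_isFaceOf {τ τ' : PointedCone ℝ (RealSpace N)} (h : τ.IsFaceOf τ') :
    gen τ ⊆ gen τ' :=
  fun _ hu => ⟨hu.1, hu.2.1.trans h, hu.2.2⟩

variable [Module.Free ℤ N] [Module.Finite ℤ N]

/-- A nondegenerate smooth cone is the nonnegative orthant of a basis. -/
theorem IsSmooth.exists_basis_mem_iff {τ : PointedCone ℝ (RealSpace N)} (hτ : IsToricCone τ)
    (hnd : IsNondegenerate τ) (hsm : IsSmooth τ) :
    ∃ B : Module.Basis (Fin (Module.finrank ℤ N)) ℝ (RealSpace N),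
      ∀ z, z ∈ τ ↔ ∀ i, 0 ≤ B.coord i z := by
  obtain ⟨b, hb⟩ := hsm
  let B := b.baseChange ℝ
  have hB : ∀ i, B i = toReal (b i) := fun i => Module.Basis.baseChange_apply _ _ _
  -- If `b i` were missing, the `i`-th coordinate would vanish on `Gen(τ)`, which spans.
  have hmem : ∀ i, b i ∈ gen τ := by
    intro i
    by_contra hi
    have hle : Submodule.span ℝ (toReal '' gen τ) ≤ LinearMap.ker (B.coord i) := by
      refine Submodule.span_le.2 ?_
      rintro _ ⟨u, hu, rfl⟩
      obtain ⟨j, rfl⟩ := hb hu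
      have : j ≠ i := by rintro rfl; exact hi hu
      rw [← hB]
      simp [this]
    rw [hτ.span_gen hnd, top_le_iff] at hle
    have : B i ∈ LinearMap.ker (B.coord i) := hle ▸ Submodule.mem_top
    simp at this
  refine ⟨B, fun z => ⟨fun hz i => ?_, fun hz => ?_⟩⟩
  · rw [← hτ.hull_gen] at hz
    refine le_on_hull (f := 0) ?_ hz
    rintro _ ⟨u, hu, rfl⟩
    obtain ⟨j, rfl⟩ := hb hu
    rw [← hB, Module.Basis.coord_apply, Module.Basis.repr_self]
    by_cases h : j = i <;> simp [h]
  · rw [← B.sum_repr z]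
    refine τ.sum_mem fun i _ => PointedCone.smul_mem τ (hz i) ?_
    rw [hB]
    exact (hmem i).2.1.le (PointedCone.subset_hull rfl)

/-- Perturb `x` to `x + y / (n + 1)` with `y` generic. By pigeonhole one cone `τ` contains
infinitely many of these points; it is nondegenerate, since differences of two of them are multiples
of `y`. The inequalities defining the orthant `τ` then pass to the limit `x`. -/
theorem Fan.IsSubdivision.exists_isNondegenerate_mem {S : Fan N}
    {σ : PointedCone ℝ (RealSpace N)} (hS : S.IsSubdivision σ) (hnd : IsNondegenerate σ)
    (hsm : ∀ τ ∈ S.cones, IsNondegenerate τ → IsSmooth τ) {x : RealSpace N} (hx : x ∈ σ) :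
    ∃ τ ∈ S.cones, IsNondegenerate τ ∧ x ∈ τ := by
  obtain ⟨y, hy, hyW⟩ := exists_mem_forall_notMem_submodule hnd
    (T := (fun τ : PointedCone ℝ (RealSpace N) => Submodule.span ℝ (τ : Set (RealSpace N))) ''
      {τ ∈ S.cones | ¬ IsNondegenerate τ})
    ((S.finite.subset (Set.sep_subset _ _)).image _) (by
      rintro _ ⟨τ, hτ, rfl⟩
      exact hτ.2)
  have hex : ∀ n : ℕ, ∃ τ : S.cones, x + (1 / (n + 1 : ℝ)) • y ∈ τ.1 := by
    intro n
    have : x + (1 / (n + 1 : ℝ)) • y ∈ (σ : Set (RealSpace N)) :=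
      σ.add_mem hx (PointedCone.smul_mem σ (by positivity) hy)
    rw [← show _ = (σ : Set (RealSpace N)) from hS] at this
    simp only [Set.mem_iUnion] at this
    obtain ⟨τ, hτ, h⟩ := this
    exact ⟨⟨τ, hτ⟩, h⟩
  choose F hF using hex
  have : Finite S.cones := S.finite
  obtain ⟨⟨τ, hτ⟩, hinf⟩ := Finite.exists_infinite_fiber F
  have hinf' : (F ⁻¹' {⟨τ, hτ⟩}).Infinite := Set.infinite_coe_iff.1 hinf
  have hFτ : ∀ n ∈ F ⁻¹' {⟨τ, hτ⟩}, x + (1 / (n + 1 : ℝ)) • y ∈ τ := fun n hn => by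
    have := hF n
    rwa [show F n = ⟨τ, hτ⟩ from hn] at this
  have hτnd : IsNondegenerate τ := by
    by_contra hdeg
    obtain ⟨n, hn, -⟩ := hinf'.exists_gt 0
    obtain ⟨m, hm, hnm⟩ := hinf'.exists_gt n
    refine hyW _ ⟨τ, ⟨hτ, hdeg⟩, rfl⟩ ?_
    have hd : (1 / (n + 1 : ℝ) - 1 / (m + 1)) ≠ 0 := by
      have : (1 / (m + 1) : ℝ) < 1 / (n + 1) := by gcongr
      linarith
    refine (Submodule.smul_mem_iff _ hd).1 ?_
    convert Submodule.sub_mem _ (Submodule.subset_span (hFτ n hn))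
      (Submodule.subset_span (hFτ m hm)) using 1
    module
  refine ⟨τ, hτ, hτnd, ?_⟩
  obtain ⟨B, hB⟩ := IsSmooth.exists_basis_mem_iff (S.isToricCone τ hτ) hτnd (hsm τ hτ hτnd)
  refine (hB x).2 fun i => ?_
  by_contra! hneg
  -- For `n > k` the `i`-th coordinate of `(n + 1) x + y` is negative.
  obtain ⟨k, hk⟩ := exists_nat_gt (B.coord i y / -B.coord i x)
  obtain ⟨n, hn, hkn⟩ := hinf'.exists_gt k
  have h := (hB _).1 (hFτ n hn) i
  rw [map_add, map_smul, smul_eq_mul, one_div] at h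
  rw [div_lt_iff₀ (by linarith)] at hk
  have hkn' : (k : ℝ) < n := by exact_mod_cast hkn
  have hn1 : (0 : ℝ) < n + 1 := by positivity
  have h2 := mul_le_mul_of_nonneg_left h hn1.le
  rw [mul_zero, mul_add, mul_inv_cancel_left₀ hn1.ne'] at h2
  nlinarith

/-- The sum of the generators of `τ` lies in some nondegenerate `τ'`. The face `τ ⊓ τ'` of `τ`
contains this sum, hence every generator, so it is `τ` itself. -/
theorem Fan.IsSubdivision.exists_isNondegenerate_isFaceOf {S : Fan N}
    {σ : PointedCone ℝ (RealSpace N)} (hS : S.IsSubdivision σ) (hnd : IsNondegenerate σ)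
    (hsm : ∀ τ ∈ S.cones, IsNondegenerate τ → IsSmooth τ) {τ : PointedCone ℝ (RealSpace N)}
    (hτ : τ ∈ S.cones) : ∃ τ' ∈ S.cones, IsNondegenerate τ' ∧ τ.IsFaceOf τ' := by
  obtain ⟨s, hs⟩ := (S.isToricCone τ hτ).rational_polyhedral
  have hmem : ∀ i : s, toReal i.1 ∈ τ := fun i => hs ▸ PointedCone.subset_hull ⟨i, i.2, rfl⟩
  have hsum : ∑ i : s, toReal i.1 ∈ τ := τ.sum_mem fun i _ => hmem i
  have hσ : ∑ i : s, toReal i.1 ∈ σ := by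
    rw [← SetLike.mem_coe, ← show _ = (σ : Set (RealSpace N)) from hS]
    exact Set.mem_biUnion hτ hsum
  obtain ⟨τ', hτ', hnd', hx⟩ := hS.exists_isNondegenerate_mem hnd hsm hσ
  refine ⟨τ', hτ', hnd', ?_⟩
  obtain ⟨h1, h2⟩ := S.inf_isFaceOf τ hτ τ' hτ'
  have hle : τ ≤ τ ⊓ τ' := by
    conv_lhs => rw [hs]
    refine Submodule.span_le.2 ?_
    rintro _ ⟨v, hv, rfl⟩
    exact h1.mem_of_sum_mem hmem ⟨hsum, hx⟩ ⟨v, hv⟩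
  rwa [le_antisymm inf_le_left hle] at h2

/-- A functional with value at most `1` on `Gen(σ)` has value at most `1` on `Gen(τ)`, for a smooth
cone `τ ⊆ σ` such that the affine span of `Gen(τ)` meets every one-dimensional face of `σ`. -/
theorem le_one_of_genSpan_meets {σ τ : PointedCone ℝ (RealSpace N)} (hσ : IsToricCone σ)
    (hle : τ ≤ σ) (hsm : IsSmooth τ)
    (hmeet : ∀ ρ : PointedCone ℝ (RealSpace N), IsRayOf ρ σ →
      ((genSpan τ : Set (RealSpace N)) ∩ (ρ : Set (RealSpace N))).Nonempty)
    {l : RealSpace N →ₗ[ℝ] ℝ} (hl : ∀ u ∈ gen σ, l (toReal u) ≤ 1) {u : N} (hu : u ∈ gen τ) :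
    l (toReal u) ≤ 1 := by
  obtain ⟨b, hb⟩ := hsm
  obtain ⟨f, hf⟩ := exists_realExtension (∑ i, b.coord i)
  have hf1 : ∀ w ∈ gen τ, f (toReal w) = 1 := by
    intro w hw
    obtain ⟨j, rfl⟩ := hb hw
    simp [hf, Finsupp.single_apply]
  have hspan : ∀ x ∈ genSpan τ, f x = 1 := by
    intro x hx
    refine affineSpan_induction (p := fun x => f x = 1) hx ?_ ?_
    · rintro _ ⟨w, hw, rfl⟩
      exact hf1 w hw
    · intro c x y z hx hy hz
      simp [hx, hy, hz]
  -- With `1` replaced by `f u`, it suffices to prove `l ≤ f` on the generators of `σ`.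
  rw [← hf1 u hu]
  refine le_on_hull (s := toReal '' gen σ) ?_ ?_
  · rintro _ ⟨v, hv, rfl⟩
    obtain ⟨x, hx, hxv⟩ := hmeet _ hv.2
    obtain ⟨c, hc, rfl⟩ := mem_hull_singleton.1 hxv
    have h := hspan _ hx
    rw [map_smul, smul_eq_mul] at h
    have hpos : 0 < f (toReal v) := by
      by_contra! hneg
      nlinarith
    refine (hl v hv).trans ?_
    rw [hf] at hpos ⊢
    -- Integrality of `f` on `N` turns `f v > 0` into `f v ≥ 1`.
    exact_mod_cast Int.add_one_le_iff.2 (by exact_mod_cast hpos : (0 : ℤ) < _)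
  · rw [hσ.hull_gen]
    exact hle (hu.2.1.le (PointedCone.subset_hull rfl))

/-- If a functional is `1` on `Gen(σ)`, then the affine span of `Gen(σ)` is the hyperplane where it
is `1`. -/
theorem genSpan_eq_hyperplane {σ : PointedCone ℝ (RealSpace N)} (hσ : IsToricCone σ)
    (hnd : IsNondegenerate σ) (hN : 0 < Module.finrank ℤ N) {l : RealSpace N →ₗ[ℝ] ℝ}
    (hl : ∀ u ∈ gen σ, l (toReal u) = 1) :
    Module.finrank ℝ (genSpan σ).direction + 1 = Module.finrank ℤ N ∧
      ∀ x, l x = 1 → x ∈ genSpan σ := by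
  have hrank : Module.finrank ℝ (RealSpace N) = Module.finrank ℤ N := Module.finrank_baseChange
  obtain ⟨v, hv⟩ : (gen σ).Nonempty := by
    by_contra! h
    have := hσ.span_gen hnd
    rw [h, Set.image_empty, Submodule.span_empty] at this
    have := finrank_top ℝ (RealSpace N) ▸ this ▸ finrank_bot ℝ (RealSpace N)
    omega
  have hvA : toReal v ∈ genSpan σ := subset_affineSpan ℝ _ ⟨v, hv, rfl⟩
  have hker : Module.finrank ℝ (LinearMap.ker l) + 1 = Module.finrank ℤ N := by
    have hsurj : LinearMap.range l = ⊤ := LinearMap.range_eq_top.2 <|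
      LinearMap.surjective fun h => by simpa [h] using hl v hv
    have := l.finrank_range_add_finrank_ker
    rw [hsurj, finrank_top, Module.finrank_self, hrank] at this
    omega
  have hdir : (genSpan σ).direction ≤ LinearMap.ker l := by
    rw [genSpan, direction_affineSpan, vectorSpan_def]
    refine Submodule.span_le.2 ?_
    rintro _ ⟨_, ⟨u, hu, rfl⟩, _, ⟨w, hw, rfl⟩, rfl⟩
    simp [hl u hu, hl w hw]
  have hsup : (genSpan σ).direction ⊔ Submodule.span ℝ {toReal v} = ⊤ := by
    rw [← top_le_iff, ← hσ.span_gen hnd]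
    refine Submodule.span_le.2 ?_
    rintro _ ⟨u, hu, rfl⟩
    rw [← sub_add_cancel (toReal u) (toReal v)]
    exact Submodule.add_mem_sup
      (AffineSubspace.vsub_mem_direction (subset_affineSpan ℝ _ ⟨u, hu, rfl⟩) hvA)
      (Submodule.mem_span_singleton_self _)
  -- The direction and one further vector span `N_ℝ`, so the direction has codimension at most one,
  -- as `ker l` does.
  have heq : (genSpan σ).direction = LinearMap.ker l := by
    refine Submodule.eq_of_le_of_finrank_le hdir ?_
    have h1 := Submodule.finrank_add_le_finrank_add_finrank (genSpan σ).direction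
      (Submodule.span ℝ {toReal v})
    rw [hsup, finrank_top, hrank] at h1
    have h2 := finrank_span_le_card (R := ℝ) ({toReal v} : Set (RealSpace N))
    simp at h2
    omega
  refine ⟨heq ▸ hker, fun x hx => ?_⟩
  have : x - toReal v ∈ (genSpan σ).direction := by
    rw [heq]; simp [hx, hl v hv]
  simpa using AffineSubspace.vadd_mem_of_mem_direction this hvA

end
end Toric

/-! ### Moderate resolutions of canonical singularities are crepant. -/

theorem corollary3p10 {N : Type*} [AddCommGroup N] [Module.Free ℤ N] [Module.Finite ℤ N]
    (hN : Module.finrank ℤ N = 3)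
    (σ : PointedCone ℝ (Toric.RealSpace N))
    (hσ : Toric.IsToricCone σ) (hnd : Toric.IsNondegenerate σ)
    (hcan : Toric.IsCanonical σ)
    (S : Toric.Fan N) (hS : S.IsModerateResolution σ) :
    S.IsCrepantResolution σ ∧
      Module.finrank ℝ (Toric.genSpan σ).direction = 2 ∧
      ∀ u ∈ S.gen, Toric.toReal u ∈ Toric.genSpan σ := by
  obtain ⟨⟨r, hr, m, hm⟩, hdisc⟩ := hcan
  have hmσ : ∀ u ∈ Toric.gen σ, (r : ℚ) = -(m u : ℚ) := fun u hu => by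
    have := congrFun hm ⟨u, hu⟩
    simp only [Pi.smul_apply, Toric.canonicalDivisor, Toric.divChar, nsmul_eq_mul] at this
    linarith
  have hrQ : (0 : ℚ) < r := by exact_mod_cast hr
  have hrR : (0 : ℝ) < r := by exact_mod_cast hr
  obtain ⟨f, hf⟩ := Toric.exists_realExtension m
  -- The sign comes from `K = -∑ D_u`: the relation `r K = div(χ^m)` makes `m = -r` on `Gen(σ)`.
  let l : Toric.RealSpace N →ₗ[ℝ] ℝ := (-(r : ℝ)⁻¹) • f
  have hl : ∀ u, l (Toric.toReal u) = -(m u : ℝ) / r :=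
    fun u => by
      simp only [l, LinearMap.smul_apply, hf, smul_eq_mul]; ring
  have hlσ : ∀ u ∈ Toric.gen σ, l (Toric.toReal u) = 1 := fun u hu => by
    rw [hl u, div_eq_one_iff_eq hrR.ne']
    exact_mod_cast (hmσ u hu).symm
  have hge : ∀ u ∈ S.gen, (r : ℚ) ≤ -(m u : ℚ) := by
    intro u hu
    -- The pullback of `K` has coefficient `m w / r` along `D_w`.
    have h := hdisc S hS.isSubdivision (fun w => (m (w : N) : ℚ) / r) ⟨r, hr, m, hm, by
      funext w
      simp only [Pi.smul_apply, Toric.divChar, nsmul_eq_mul]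
      field_simp⟩ ⟨u, hu⟩
    simp only [Pi.sub_apply, Toric.canonicalDivisor] at h
    have h' : (m u : ℚ) / r ≤ -1 := by linarith
    rw [div_le_iff₀ hrQ] at h'
    linarith
  have hface : ∀ τ ∈ S.cones, ∃ τ' ∈ S.cones, Toric.IsNondegenerate τ' ∧ τ.IsFaceOf τ' :=
    fun τ hτ => hS.isSubdivision.exists_isNondegenerate_isFaceOf hnd hS.isSmooth hτ
  have hone : ∀ u ∈ S.gen, (r : ℚ) = -(m u : ℚ) := by
    intro u hu
    refine le_antisymm (hge u hu) ?_
    obtain ⟨τ, hτ, huτ⟩ := Set.mem_iUnion₂.1 hu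
    obtain ⟨τ', hτ', hnd', hF⟩ := hface τ hτ
    have hle : τ' ≤ σ := fun x hx => by
      rw [← SetLike.mem_coe, ← show _ = (σ : Set (Toric.RealSpace N)) from hS.isSubdivision]
      exact Set.mem_biUnion hτ' hx
    have h := Toric.le_one_of_genSpan_meets hσ hle (hS.isSmooth τ' hτ' hnd')
      (hS.meets τ' hτ' hnd') (fun u hu => (hlσ u hu).le) (Toric.gen_subset_of_isFaceOf hF huτ)
    rw [hl u, div_le_one hrR] at h
    exact_mod_cast h
  obtain ⟨hdim, hmem⟩ := Toric.genSpan_eq_hyperplane hσ hnd (by omega) hlσ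
  refine ⟨⟨⟨hS.isSubdivision, fun τ hτ => ?_⟩, r, hr, m, hm, ?_⟩, by omega, fun u hu => ?_⟩
  · obtain ⟨τ', hτ', hnd', hF⟩ := hface τ hτ
    obtain ⟨b, hb⟩ := hS.isSmooth τ' hτ' hnd'
    exact ⟨b, (Toric.gen_subset_of_isFaceOf hF).trans hb⟩
  · funext u
    have := hone u u.2
    simp only [Pi.smul_apply, Toric.canonicalDivisor, Toric.divChar, nsmul_eq_mul]
    linarith
  · refine hmem _ ?_
    rw [hl u, div_eq_one_iff_eq hrR.ne']
    exact_mod_cast (hone u hu).symm
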